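/- Let $n\ge 1$ and let $x_0,x_1,x_2,\dots$ be real rates with $x_0>0$, $x_1>0$ and $x_j\ge 0$ for $2\le j\le n-1$; put $y_k:=x_0+x_1+\cdots+x_k$. Let $C_n$ be the set of compositions of $n$, i.e. of tuples $c=(c_1,\dots,c_\ell)$ of positive integers with sum $n$; $\ell$ is the length of $c$. For $0\le j\le n-1$ define $T_j:C_n\to C_n$ by \[ T_j(c)=\begin{cases}(1,c_1,\dots,c_{\ell-1},c_\ell-1)& j=0,\\ (c_1,\dots,c_{j-1},c_j+1,c_{j+1},\dots,c_{\ell-1},c_\ell-1)& 1\le j\le \ell-1,\\ c& j\ge \ell,\end{cases} \] where in the first two cases the last part is deleted if $c_\ell=1$. Let $Y^{(n)}$ be the continuous-time Markov chain on $C_n$ that makes a transition from $c$ to $T_j(c)$ at rate $x_j$ for each $0\le j\le n-1$. Then $Y^{(n)}$ has a unique stationary distribution $\pi_{Y^{(n)}}$, and the following hold. (1) For all $\alpha\ge 1$ and $\ell\ge 2$ with $\alpha+\ell-1=n$, the composition $c_\ell(\alpha)=(\alpha,1,\dots,1)$ of length $\ell$ satisfies \[ \pi_{Y^{(n)}}(c_\ell(\alpha))=\frac{x_0^{\ell-1}x_1^{\alpha-1}}{y_{\ell-1}^{\alpha}\prod_{k=1}^{\ell-2}y_k}.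 \] (2) If $x_2=\cdots=x_{n-1}=0$, then every composition $c\in C_n$ of length $\ell$ satisfies \[ \pi_{Y^{(n)}}(c)=\frac{x_0^{\ell-1}x_1^{n-\ell}}{y_1^{n-1}}. \] -/

import Mathlib

open Finset BigOperators

namespace HilbertGalton

/-- Add one ball: for `j = 0` a new leftmost bin holding one ball is created, and for `j ≥ 1` the
`j`-th bin (numbered from `1`, from left to right) receives one more ball. -/
def addBall : ℕ → List ℕ → List ℕ
  | 0, l => 1 :: l
  | _ + 1, [] => []
  | 0 + 1, a :: l => (a + 1) :: l
  | (j + 1) + 1, a :: l => a :: addBall (j + 1) l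

/-- Delete one ball from the last (rightmost) bin, and delete that bin if it becomes empty. -/
def removeLastBall : List ℕ → List ℕ
  | [] => []
  | [a] => if a = 1 then [] else [a - 1]
  | a :: b :: l => a :: removeLastBall (b :: l)

theorem addBall_pos (j : ℕ) (l : List ℕ) (hl : ∀ i ∈ l, 0 < i) :
    ∀ i ∈ addBall j l, 0 < i := by
  fun_induction addBall j l <;> simp_all

theorem addBall_sum (j : ℕ) (l : List ℕ) (hj : j ≤ l.length) :
    (addBall j l).sum = l.sum + 1 := by
  fun_induction addBall j l <;> simp_all <;> omega

theorem removeLastBall_pos (l : List ℕ) (hl : ∀ i ∈ l, 0 < i) :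
    ∀ i ∈ removeLastBall l, 0 < i := by
  fun_induction removeLastBall l <;> simp_all
  omega

theorem removeLastBall_sum (l : List ℕ) (hl : ∀ i ∈ l, 0 < i) :
    (removeLastBall l).sum = l.sum - 1 := by
  fun_induction removeLastBall l <;> simp_all
  omega

/-- The transition map `T_j` on the compositions `c = (c_1, …, c_ℓ)` of `n`:
`T_0 c = (1, c_1, …, c_ℓ - 1)`, `T_j c = (c_1, …, c_j + 1, …, c_ℓ - 1)` for `1 ≤ j ≤ ℓ - 1`
(the last part is deleted if it becomes `0`), and `T_j c = c` for `j ≥ ℓ`. -/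
def transition {n : ℕ} (j : ℕ) (c : Composition n) : Composition n :=
  if h : j < c.length then
    { blocks := removeLastBall (addBall j c.blocks)
      blocks_pos := fun {i} hi =>
        removeLastBall_pos _ (addBall_pos j c.blocks fun _ hk => c.blocks_pos hk) i hi
      blocks_sum := by
        rw [removeLastBall_sum _ (addBall_pos j c.blocks fun _ hk => c.blocks_pos hk),
          addBall_sum j c.blocks h.le, c.blocks_sum, Nat.add_sub_cancel] }
  else c

/-- The generator (rows are indexed by the starting state) of the continuous-time Markov chain
`Y^(n)` on the compositions of `n` which jumps from `c` to `T_j c` at rate `x_j`, for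
`0 ≤ j ≤ n - 1`. -/
def generator (n : ℕ) (x : ℕ → ℝ) : Matrix (Composition n) (Composition n) ℝ :=
  fun c c' => ∑ j ∈ range n,
    x j * ((if transition j c = c' then 1 else 0) - (if c = c' then 1 else 0))

/-- The transition probabilities at time `t` of the chain `Y^(n)`: the matrix `exp (t Q)`, where
`Q` is the generator. -/
noncomputable def transitionProb (n : ℕ) (x : ℕ → ℝ) (t : ℝ) :
    Matrix (Composition n) (Composition n) ℝ :=
  NormedSpace.exp (t • generator n x)

/-- `p` is a stationary distribution of the chain `Y^(n)` with rates `x_0, …, x_{n-1}`: it is a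
probability vector which is preserved by the evolution of the chain up to any time `t ≥ 0`. -/
def IsStationaryDistribution (n : ℕ) (x : ℕ → ℝ) (p : Composition n → ℝ) : Prop :=
  (∀ c, 0 ≤ p c) ∧ ∑ c, p c = 1 ∧
    ∀ t : ℝ, 0 ≤ t → Matrix.vecMul p (transitionProb n x t) = p

/-- `y_k = x_0 + x_1 + ⋯ + x_k`. -/
def y (x : ℕ → ℝ) (k : ℕ) : ℝ := ∑ i ∈ range (k + 1), x i

/-- The composition `c_ℓ(α) = (α, 1, …, 1)` of length `ℓ`, as a composition of
`n = α + (ℓ - 1)`. -/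
def hook {n : ℕ} (α l : ℕ) (hα : 1 ≤ α) (hn : α + (l - 1) = n) : Composition n where
  blocks := α :: List.replicate (l - 1) 1
  blocks_pos := fun {i} hi => by
    rcases List.mem_cons.1 hi with rfl | h
    · exact hα
    · rw [List.eq_of_mem_replicate h]; exact Nat.one_pos
  blocks_sum := by simp [hn]

end HilbertGalton

/-! Removing the last ball commutes with every `T_j` (`truncate_transition`), so it carries the
balanced measure for `n + 1` to the one for `n` (`IsBalanced.inflow_truncate`). Moreover, as long as
bin `j` survives the removal, `T_j c` depends on `c` only through its truncation
(`transition_blocks`). Hence the mass that `T_0` sends to `(1, d)` is the smaller stationary mass of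
`d`, and the mass that `T_1` sends to `(a + 2, t)` is that of `(a + 1, t)`. For hooks, or when only
`x_0` and `x_1` act, the other rates only contribute multiples of the mass at `c` itself, and the
balance equation becomes a one-term recursion in `n`.

Existence and uniqueness hold because the absolute value of an invariant signed measure is invariant
and every nonzero invariant measure charges `(1, …, 1)`. -/

namespace HilbertGalton

/-! ### Adding and removing balls on lists. -/

section Lists

theorem removeLastBall_append (s t : List ℕ) (ht : t ≠ []) :
    removeLastBall (s ++ t) = s ++ removeLastBall t := by
  induction s with
  | nil => rfl
  | cons a s ih =>
    cases h : s ++ t with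
    | nil => simp_all
    | cons b u => rw [List.cons_append, h, removeLastBall, ← h, ih, List.cons_append]

theorem le_length_removeLastBall {l : List ℕ} {j : ℕ} (h : j < l.length) :
    j ≤ (removeLastBall l).length := by
  induction l using removeLastBall.induct generalizing j with
  | case1 => simp at h
  | case2 => simp at h; omega
  | case3 => simp at h; omega
  | case4 a b l ih =>
    rw [removeLastBall, List.length_cons]
    have := @ih (j - 1) (by simp at h ⊢; omega)
    omega

theorem length_removeLastBall_le (l : List ℕ) : (removeLastBall l).length ≤ l.length := by
  fun_induction removeLastBall l <;> simp_all

/-- Adding a ball to the last bin and then removing the last ball changes nothing. -/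
theorem removeLastBall_addBall_length (l : List ℕ) (hl : ∀ i ∈ l, 0 < i) :
    removeLastBall (addBall l.length l) = l := by
  induction l with
  | nil => simp [addBall, removeLastBall]
  | cons a l ih =>
    cases l with
    | nil =>
      have : a ≠ 0 := by have := hl a; simp at this; omega
      simp [addBall, removeLastBall, this]
    | cons b l =>
      have ih := ih (fun i hi => hl i (by simp [hi]))
      have hne : addBall (b :: l).length (b :: l) ≠ [] := by
        cases l <;> simp [addBall]
      rw [List.length_cons, List.length_cons, addBall]
      rw [List.length_cons] at ih hne
      obtain ⟨d, u, hu⟩ := List.exists_cons_of_ne_nil hne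
      rw [hu, removeLastBall, ← hu, ih]

theorem addBall_ne_nil {j : ℕ} {l : List ℕ} (hj : j ≤ l.length) : addBall j l ≠ [] := by
  fun_induction addBall j l <;> simp_all

/-- The bound on `j` says that the receiving bin is still there after the removal. -/
theorem addBall_removeLastBall {j : ℕ} {l : List ℕ} (hl : ∀ i ∈ l, 0 < i) (hne : l ≠ [])
    (hj : j ≤ (removeLastBall l).length) :
    addBall j (removeLastBall l) = removeLastBall (addBall j l) := by
  induction l using removeLastBall.induct generalizing j with
  | case1 => simp at hne
  | case2 =>
    simp [removeLastBall] at hj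
    subst hj
    simp [addBall, removeLastBall]
  | case3 a ha =>
    have : 0 < a := hl a (by simp)
    match j with
    | 0 => simp [addBall, removeLastBall, ha]
    | 1 =>
      simp [addBall, removeLastBall, ha]
      rw [if_neg (by omega)]; simp; omega
    | j + 2 => simp [removeLastBall, ha] at hj
  | case4 a b l ih =>
    match j with
    | 0 => simp [addBall, removeLastBall]
    | 1 => simp [addBall, removeLastBall]
    | j + 2 =>
      rw [removeLastBall, List.length_cons] at hj
      have hj' : j + 1 ≤ (removeLastBall (b :: l)).length := by omega
      have h := ih (j := j + 1) (fun i hi => hl i (by simp [hi])) (by simp) hj'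
      rw [removeLastBall, addBall, addBall, h]
      have hne' : addBall (j + 1) (b :: l) ≠ [] :=
        addBall_ne_nil (hj'.trans (length_removeLastBall_le _))
      obtain ⟨d, u, hu⟩ := List.exists_cons_of_ne_nil hne'
      rw [hu, removeLastBall]

/-- After a ball is added to bin `j + 2`, the tail of the list has a part that exceeds `1`. -/
theorem exists_tail_addBall {j : ℕ} {l : List ℕ} (hl : ∀ i ∈ l, 0 < i) (hj : j + 2 ≤ l.length) :
    ∃ i ∈ (addBall (j + 2) l).tail, 2 ≤ i := by
  induction j generalizing l with
  | zero =>
    match l with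
    | a :: b :: l =>
      have := hl b (by simp)
      exact ⟨b + 1, by simp [addBall], by omega⟩
  | succ j ih =>
    match l with
    | a :: l =>
      obtain ⟨i, hi, h⟩ := ih (l := l) (fun i hi => hl i (by simp [hi])) (by simp at hj; omega)
      exact ⟨i, by rw [addBall, List.tail_cons]; exact List.mem_of_mem_tail hi, h⟩

end Lists

/-! ### Truncation intertwines the chains for `n + 1` and `n`. -/

section Transition

variable {n : ℕ}

/-- The composition of `n` obtained by removing the last ball of a composition of `n + 1`. -/
def truncate (c : Composition (n + 1)) : Composition n where
  blocks := removeLastBall c.blocks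
  blocks_pos := fun {i} hi => removeLastBall_pos _ (fun _ hk => c.blocks_pos hk) i hi
  blocks_sum := by rw [removeLastBall_sum _ (fun _ hk => c.blocks_pos hk), c.blocks_sum]; rfl

theorem blocks_ne_nil (c : Composition (n + 1)) : c.blocks ≠ [] := by
  intro h
  have := c.blocks_sum
  simp [h] at this

theorem transition_blocks_of_lt {j : ℕ} {c : Composition n} (h : j < c.length) :
    (transition j c).blocks = removeLastBall (addBall j c.blocks) := by
  rw [transition, dif_pos h]

theorem transition_of_le {j : ℕ} {c : Composition n} (h : c.length ≤ j) :
    transition j c = c := by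
  rw [transition, dif_neg (by omega)]

theorem transition_blocks {j : ℕ} (c : Composition (n + 1))
    (h : j ≤ (truncate c).blocks.length) :
    (transition j c).blocks = addBall j (truncate c).blocks := by
  have hc : ∀ i ∈ c.blocks, 0 < i := fun _ hk => c.blocks_pos hk
  have e := addBall_removeLastBall hc (blocks_ne_nil c) h
  rcases lt_or_ge j c.length with hj | hj
  · rw [transition_blocks_of_lt hj]; exact e.symm
  -- Boundary case: the last bin survives the removal, so giving the ball back to it restores `c`,
  -- in agreement with the idle `T_j`.
  · have : j = c.blocks.length := le_antisymm (h.trans (length_removeLastBall_le _)) hj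
    rw [transition_of_le hj]
    refine Eq.trans ?_ e.symm
    rw [this, removeLastBall_addBall_length _ hc]

theorem truncate_transition (j : ℕ) (c : Composition (n + 1)) :
    truncate (transition j c) = transition j (truncate c) := by
  have hc : ∀ i ∈ (truncate c).blocks, 0 < i := fun _ hk => (truncate c).blocks_pos hk
  rcases le_or_gt j (truncate c).blocks.length with h | h
  · have e : (truncate (transition j c)).blocks
        = removeLastBall (addBall j (truncate c).blocks) := by
      rw [← transition_blocks c h]; rfl
    apply Composition.ext
    rw [e]
    rcases h.lt_or_eq with h | h
    · rw [transition_blocks_of_lt h]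
    · rw [transition_of_le h.ge, h, removeLastBall_addBall_length _ hc]
  -- Removal deletes at most one bin, so here `T_j` is idle both before and after truncation.
  · rw [transition_of_le (c := truncate c) h.le, transition_of_le]
    by_contra hj
    exact absurd (le_length_removeLastBall (not_le.1 hj)) (not_le.2 h)

end Transition

/-! ### Push-forward of signed measures along maps of finite sets. -/

section PushForward

variable {ι κ : Type*} [Fintype ι] [DecidableEq κ]

/-- The push-forward of `v` along `T`: the mass that the map `T` sends to the state `c`. -/
def inflow (T : ι → κ) (v : ι → ℝ) (c : κ) : ℝ :=
  ∑ c', if T c' = c then v c' else 0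

theorem sum_inflow [Fintype κ] (T : ι → κ) (v : ι → ℝ) : ∑ c, inflow T v c = ∑ c, v c := by
  simp only [inflow]
  rw [Finset.sum_comm]
  simp

theorem inflow_inflow [Fintype κ] {μ : Type*} [DecidableEq μ] (T : ι → κ) (S : κ → μ) (v : ι → ℝ) (c : μ) :
    inflow S (inflow T v) c = inflow (fun i => S (T i)) v c := by
  have h : ∀ k, (if S k = c then ∑ i, (if T i = k then v i else 0) else 0)
      = ∑ i, if T i = k then (if S k = c then v i else 0) else 0 := fun k => by
    split_ifs <;> simp
  simp only [inflow, h]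
  rw [Finset.sum_comm]
  simp

theorem inflow_congr {κ' : Type*} [DecidableEq κ'] {T : ι → κ} {S : ι → κ'} {c : κ} {d : κ'}
    (h : ∀ i, T i = c ↔ S i = d) (v : ι → ℝ) : inflow T v c = inflow S v d := by
  simp only [inflow, h]

theorem inflow_eq_zero {T : ι → κ} {c : κ} (h : ∀ i, T i ≠ c) (v : ι → ℝ) :
    inflow T v c = 0 := by
  simp only [inflow, h, if_false, Finset.sum_const_zero]

theorem inflow_id [DecidableEq ι] (v : ι → ℝ) (c : ι) : inflow (fun i => i) v c = v c := by
  simp [inflow]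

theorem abs_inflow_le (T : ι → κ) (v : ι → ℝ) (c : κ) : |inflow T v c| ≤ inflow T |v| c := by
  refine (Finset.abs_sum_le_sum_abs _ _).trans (Finset.sum_le_sum fun i _ => ?_)
  split_ifs <;> simp

theorem le_inflow {T : ι → κ} {v : ι → ℝ} (hv : 0 ≤ v) (c : ι) : v c ≤ inflow T v (T c) := by
  have := Finset.single_le_sum (f := fun c' => if T c' = T c then v c' else 0)
    (fun i _ => by split_ifs; exacts [hv i, le_rfl]) (mem_univ c)
  simpa [inflow] using this

theorem inflow_nonneg {T : ι → κ} {v : ι → ℝ} (hv : 0 ≤ v) (c : κ) : 0 ≤ inflow T v c :=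
  Finset.sum_nonneg fun i _ => by split_ifs; exacts [hv i, le_rfl]

theorem inflow_sum_mul_sub {α : Type*} (T : ι → κ) (s : Finset α) (x : α → ℝ) (f : α → ι → ℝ)
    (v : ι → ℝ) (c : κ) : inflow T (fun i => ∑ j ∈ s, x j * (f j i - v i)) c
      = ∑ j ∈ s, x j * (inflow T (f j) c - inflow T v c) := by
  simp only [inflow, ← Finset.sum_sub_distrib, Finset.mul_sum]
  rw [Finset.sum_comm]
  refine Finset.sum_congr rfl fun i _ => ?_
  split_ifs <;> simp

end PushForward

/-! ### Invariant measures of chains driven by random maps. -/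

section RandomMaps

variable {ι : Type*} [Fintype ι] [DecidableEq ι]

/-- The generator of the chain on `ι` that jumps from `c` to `T j c` at rate `x j`, `j < n`. -/
def mapGenerator (n : ℕ) (x : ℕ → ℝ) (T : ℕ → ι → ι) : Matrix ι ι ℝ :=
  fun c c' => ∑ j ∈ range n, x j * ((if T j c = c' then 1 else 0) - (if c = c' then 1 else 0))

variable {n : ℕ} {x : ℕ → ℝ} {T : ℕ → ι → ι}

theorem vecMul_mapGenerator (v : ι → ℝ) (c : ι) :
    Matrix.vecMul v (mapGenerator n x T) c = ∑ j ∈ range n, x j * (inflow (T j) v c - v c) := by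
  simp only [Matrix.vecMul, dotProduct, mapGenerator, Finset.mul_sum, inflow]
  rw [Finset.sum_comm]
  refine Finset.sum_congr rfl fun j _ => ?_
  simp only [mul_sub, Finset.sum_sub_distrib, Finset.mul_sum]
  congr 1
  · exact Finset.sum_congr rfl fun i _ => by split_ifs <;> ring
  · simp [mul_comm]

theorem vecMul_mapGenerator_eq_zero_iff {v : ι → ℝ} :
    Matrix.vecMul v (mapGenerator n x T) = 0 ↔
      ∀ c, ∑ j ∈ range n, x j * inflow (T j) v c = (∑ j ∈ range n, x j) * v c := by
  simp only [funext_iff, vecMul_mapGenerator, Pi.zero_apply, mul_sub, Finset.sum_sub_distrib,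
    Finset.sum_mul, sub_eq_zero]

/-- The absolute value of an invariant signed measure is invariant. -/
theorem vecMul_mapGenerator_abs (hx : ∀ j, j < n → 0 ≤ x j) {v : ι → ℝ}
    (hv : Matrix.vecMul v (mapGenerator n x T) = 0) :
    Matrix.vecMul |v| (mapGenerator n x T) = 0 := by
  rw [vecMul_mapGenerator_eq_zero_iff] at hv ⊢
  have hX : 0 ≤ ∑ j ∈ range n, x j := Finset.sum_nonneg fun j hj => hx j (mem_range.1 hj)
  have hle : ∀ c ∈ (univ : Finset ι), (∑ j ∈ range n, x j) * |v| c
      ≤ ∑ j ∈ range n, x j * inflow (T j) |v| c := by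
    intro c _
    have : (∑ j ∈ range n, x j) * |v| c = |∑ j ∈ range n, x j * inflow (T j) v c| := by
      rw [hv c, abs_mul, abs_of_nonneg hX, Pi.abs_apply]
    rw [this]
    refine (Finset.abs_sum_le_sum_abs _ _).trans (Finset.sum_le_sum fun j hj => ?_)
    have hxj := hx j (mem_range.1 hj)
    rw [abs_mul, abs_of_nonneg hxj]
    exact mul_le_mul_of_nonneg_left (abs_inflow_le _ _ _) hxj
  -- Push-forward preserves total mass, so the two sides of `hle` have equal sums and must agree
  -- termwise.
  have hsum : ∑ c, (∑ j ∈ range n, x j) * |v| c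
      = ∑ c, ∑ j ∈ range n, x j * inflow (T j) |v| c := by
    rw [Finset.sum_comm]
    simp only [← Finset.mul_sum, sum_inflow]
    rw [Finset.sum_mul]
  exact fun c => (((Finset.sum_eq_sum_iff_of_le hle).1 hsum) c (mem_univ c)).symm

/-- The rows of the generator sum to zero, so it is singular and has a left null vector; its
normalized absolute value is the required measure. -/
theorem exists_vecMul_mapGenerator_eq_zero [Nonempty ι] (hx : ∀ j, j < n → 0 ≤ x j) :
    ∃ p : ι → ℝ, (∀ c, 0 ≤ p c) ∧ ∑ c, p c = 1 ∧ Matrix.vecMul p (mapGenerator n x T) = 0 := by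
  have h1 : Matrix.mulVec (mapGenerator n x T) 1 = 0 := by
    ext c
    simp only [Matrix.mulVec, dotProduct, mapGenerator, Pi.one_apply, mul_one, Pi.zero_apply]
    rw [Finset.sum_comm]
    simp [← Finset.mul_sum, Finset.sum_sub_distrib]
  obtain ⟨v, hv0, hv⟩ := Matrix.exists_vecMul_eq_zero_iff.2
    (Matrix.exists_mulVec_eq_zero_iff.1 ⟨1, one_ne_zero, h1⟩)
  have hpos : 0 < ∑ c, |v| c := by
    obtain ⟨c, hc⟩ := Function.ne_iff.1 hv0
    exact Finset.sum_pos' (fun i _ => abs_nonneg _) ⟨c, mem_univ c, abs_pos.2 hc⟩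
  refine ⟨(∑ c, |v| c)⁻¹ • |v|, fun c => mul_nonneg (inv_nonneg.2 hpos.le) (abs_nonneg _), ?_, ?_⟩
  · simp only [Pi.smul_apply, smul_eq_mul, ← Finset.mul_sum]
    exact inv_mul_cancel₀ hpos.ne'
  · rw [Matrix.smul_vecMul, vecMul_mapGenerator_abs hx hv, smul_zero]

theorem pos_map_of_pos (hx : ∀ j, j < n → 0 ≤ x j) {v : ι → ℝ} (hv0 : 0 ≤ v)
    (hv : Matrix.vecMul v (mapGenerator n x T) = 0) {j : ℕ} (hj : j < n) (hxj : 0 < x j) {c : ι}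
    (hc : 0 < v c) : 0 < v (T j c) := by
  have h := vecMul_mapGenerator_eq_zero_iff.1 hv (T j c)
  have h1 : 0 < ∑ i ∈ range n, x i * inflow (T i) v (T j c) :=
    Finset.sum_pos' (fun i hi => mul_nonneg (hx i (mem_range.1 hi)) (inflow_nonneg hv0 _))
      ⟨j, mem_range.2 hj, mul_pos hxj (hc.trans_le (le_inflow hv0 c))⟩
  rw [h] at h1
  exact pos_of_mul_pos_right h1 (Finset.sum_nonneg fun i hi => hx i (mem_range.1 hi))

/-- If every nonzero invariant measure charges the state `o`, then an invariant signed measure of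
total mass zero vanishes. -/
theorem eq_zero_of_vecMul_mapGenerator (hx : ∀ j, j < n → 0 ≤ x j) (o : ι)
    (ho : ∀ v : ι → ℝ, 0 ≤ v → Matrix.vecMul v (mapGenerator n x T) = 0 →
      (∃ c, 0 < v c) → 0 < v o)
    {v : ι → ℝ} (hv : Matrix.vecMul v (mapGenerator n x T) = 0) (hs : ∑ c, v c = 0) : v = 0 := by
  have ha := vecMul_mapGenerator_abs hx hv
  by_contra hne
  have hplus := ho (|v| + v) (fun c => neg_le_iff_add_nonneg'.1 (neg_abs_le (v c)))
    (by rw [Matrix.add_vecMul, ha, hv, add_zero])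
  have hminus := ho (|v| - v) (fun c => by simpa using le_abs_self (v c))
    (by rw [Matrix.sub_vecMul, ha, hv, sub_zero])
  obtain ⟨c, hc⟩ : ∃ c, v c ≠ 0 := Function.ne_iff.1 hne
  obtain ⟨a, -, hapos⟩ := Finset.exists_pos_of_sum_zero_of_exists_nonzero v hs ⟨c, mem_univ c, hc⟩
  obtain ⟨b, -, hbneg⟩ := Finset.exists_pos_of_sum_zero_of_exists_nonzero (fun i => -v i)
    (by simp [hs]) ⟨c, mem_univ c, by simpa using hc⟩
  have h1 := hplus ⟨a, by simp only [Pi.add_apply, Pi.abs_apply]; positivity⟩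
  have h2 := hminus ⟨b, by
    simp only [Pi.sub_apply, Pi.abs_apply]; have := abs_nonneg (v b); linarith⟩
  simp only [Pi.add_apply, Pi.sub_apply, Pi.abs_apply] at h1 h2
  -- One of `|v| + v` and `|v| - v` vanishes at `o`, yet both would have to charge it.
  rcases abs_cases (v o) with h | h <;> linarith

end RandomMaps

/-! ### Invariance under the semigroup versus the generator equation. -/

section Exponential

variable {ι : Type*} [Fintype ι] [DecidableEq ι]

attribute [local instance] Matrix.linftyOpNormedRing Matrix.linftyOpNormedAlgebra

theorem vecMul_exp_smul_eq_iff (p : ι → ℝ) (Q : Matrix ι ι ℝ) :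
    (∀ t : ℝ, 0 ≤ t → Matrix.vecMul p (NormedSpace.exp (t • Q)) = p) ↔ Matrix.vecMul p Q = 0 := by
  let L : Matrix ι ι ℝ →L[ℝ] (ι → ℝ) := LinearMap.toContinuousLinearMap
    { toFun := fun M => Matrix.vecMul p M
      map_add' := fun M N => Matrix.vecMul_add M N p
      map_smul' := fun a M => Matrix.vecMul_smul p a M }
  have hd : ∀ t : ℝ, HasDerivAt (fun t : ℝ => Matrix.vecMul p (NormedSpace.exp (t • Q)))
      (Matrix.vecMul p (Q * NormedSpace.exp (t • Q))) t := fun t =>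
    L.hasFDerivAt.comp_hasDerivAt t (hasDerivAt_exp_smul_const' (𝕂 := ℝ) Q t)
  constructor
  · intro h
    -- Invariance is known only for `t ≥ 0`, so the one-sided derivative at `0` is compared.
    have h0 := (hd 0).hasDerivWithinAt (s := Set.Ici 0)
    rw [zero_smul, NormedSpace.exp_zero, mul_one] at h0
    have h1 : HasDerivWithinAt (fun t : ℝ => Matrix.vecMul p (NormedSpace.exp (t • Q))) 0
        (Set.Ici 0) 0 :=
      (hasDerivWithinAt_const (0 : ℝ) (Set.Ici 0) p).congr (fun t ht => h t ht) (h 0 le_rfl)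
    exact (uniqueDiffOn_Ici (0 : ℝ) 0 Set.self_mem_Ici).eq_deriv _ h0 h1
  · intro h t _
    have hc := is_const_of_deriv_eq_zero (fun t => (hd t).differentiableAt)
      (fun t => by rw [(hd t).deriv, ← Matrix.vecMul_vecMul, h, Matrix.zero_vecMul]) t 0
    simpa using hc

end Exponential

/-- `p` has total mass `1` and is annihilated by the generator of `Y^(n)`. -/
def IsBalanced (n : ℕ) (x : ℕ → ℝ) (p : Composition n → ℝ) : Prop :=
  ∑ c, p c = 1 ∧ Matrix.vecMul p (generator n x) = 0

theorem isStationaryDistribution_iff {n : ℕ} {x : ℕ → ℝ} {p : Composition n → ℝ} :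
    IsStationaryDistribution n x p ↔ (∀ c, 0 ≤ p c) ∧ IsBalanced n x p := by
  rw [IsStationaryDistribution, IsBalanced, ← vecMul_exp_smul_eq_iff]
  rfl

theorem generator_eq_mapGenerator (n : ℕ) (x : ℕ → ℝ) :
    generator n x = mapGenerator n x transition := rfl

/-! ### Existence and uniqueness of the stationary distribution. -/

section Uniqueness

variable {n : ℕ} {x : ℕ → ℝ}

/-- A nonzero measure balanced for `Y^(n)` charges `(1, …, 1)`, which `T_0` reaches from every
composition. -/
theorem pos_ones_of_balanced (hx : ∀ j, j < n → 0 ≤ x j) (hx0 : 0 < x 0)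
    {v : Composition n → ℝ} (hv0 : 0 ≤ v) (hv : Matrix.vecMul v (generator n x) = 0)
    (hc : ∃ c, 0 < v c) : 0 < v (Composition.ones n) := by
  -- Each use of `T_0` puts one more `1` in front while positive mass is kept.
  have key : ∀ k, k ≤ n → ∃ c, 0 < v c ∧ ∃ t, c.blocks = List.replicate k 1 ++ t := by
    intro k
    induction k with
    | zero => exact fun _ => hc.imp fun c h => ⟨h, c.blocks, rfl⟩
    | succ k ih =>
      intro hk
      obtain ⟨c, hc, t, ht⟩ := ih (by omega)
      have hne : t ≠ [] := by
        rintro rfl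
        have := c.blocks_sum
        simp [ht] at this
        omega
      have hlen : 0 < c.length := by
        rw [Composition.length, ht, List.length_append]
        have := List.length_pos_of_ne_nil hne
        omega
      refine ⟨transition 0 c, pos_map_of_pos hx hv0 hv (by omega) hx0 hc, removeLastBall t, ?_⟩
      rw [transition_blocks_of_lt hlen, ht, addBall, ← List.cons_append, ← List.replicate_succ,
        removeLastBall_append _ _ hne]
  obtain ⟨c, hc, t, ht⟩ := key n le_rfl
  have hs := c.blocks_sum
  have ht0 : t = [] := by
    rw [ht, List.sum_append, List.sum_replicate, smul_eq_mul, mul_one] at hs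
    rcases t with _ | ⟨a, t⟩
    · rfl
    · have : 0 < a := c.blocks_pos (by rw [ht]; simp)
      simp at hs
      omega
  have : c = Composition.ones n := by
    apply Composition.ext
    rw [ht, ht0, List.append_nil]
    rfl
  rwa [← this]

theorem existsUnique_isStationaryDistribution (hx : ∀ j, j < n → 0 ≤ x j) (hx0 : 0 < x 0) :
    ∃! p : Composition n → ℝ, IsStationaryDistribution n x p := by
  have : Nonempty (Composition n) := ⟨Composition.ones n⟩
  obtain ⟨p, hp⟩ := exists_vecMul_mapGenerator_eq_zero (T := transition (n := n)) hx
  refine ⟨p, isStationaryDistribution_iff.2 hp, fun q hq => ?_⟩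
  obtain ⟨-, hq1, hq⟩ := isStationaryDistribution_iff.1 hq
  refine sub_eq_zero.1 (eq_zero_of_vecMul_mapGenerator (T := transition) hx (Composition.ones n)
    (fun v hv0 hv hc => pos_ones_of_balanced hx hx0 hv0 hv hc) ?_ ?_)
  · rw [Matrix.sub_vecMul, hp.2.2, ← generator_eq_mapGenerator, hq, sub_zero]
  · simp [Finset.sum_sub_distrib, hp.2.1, hq1]

end Uniqueness

/-! ### The balance equation as a recursion in `n`. -/

section Recursion

variable {n : ℕ} {x : ℕ → ℝ}

/-- Removing the last ball maps the stationary distribution of `Y^(n+1)` to that of `Y^(n)`. -/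
theorem IsBalanced.inflow_truncate {p : Composition (n + 1) → ℝ} (hp : IsBalanced (n + 1) x p) :
    IsBalanced n x (inflow truncate p) := by
  refine ⟨by rw [sum_inflow, hp.1], ?_⟩
  funext d
  have h := fun c => (vecMul_mapGenerator (T := transition) (x := x) p c).symm.trans
    (congrFun hp.2 c)
  have h2 : inflow truncate
      (fun c => ∑ j ∈ range (n + 1), x j * (inflow (transition j) p c - p c)) d = 0 := by
    rw [funext h]
    simp [inflow]
  have h4 : ∀ j, inflow truncate (inflow (transition j) p) d
      = inflow (transition j) (inflow truncate p) d := fun j => by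
    simp only [inflow_inflow, truncate_transition]
  -- The extra rate `x_n` of the larger chain is harmless: `T_n` is the identity on compositions of
  -- `n`.
  have h5 : inflow (transition n) (inflow truncate p) d = inflow truncate p d := by
    rw [inflow_congr (S := fun i => i) (d := d)
      (fun i => by rw [transition_of_le i.length_le]), inflow_id]
  rw [generator_eq_mapGenerator, vecMul_mapGenerator, Pi.zero_apply, ← h2, inflow_sum_mul_sub,
    Finset.sum_range_succ]
  simp only [h4, h5, sub_self, mul_zero, add_zero]

theorem transition_zero_eq_iff {c c' : Composition (n + 1)} {d : Composition n}
    (h : c.blocks = 1 :: d.blocks) : transition 0 c' = c ↔ truncate c' = d := by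
  rw [Composition.ext_iff, Composition.ext_iff, transition_blocks c' (Nat.zero_le _), addBall, h]
  simp

theorem transition_zero_ne {c c' : Composition (n + 1)} {a : ℕ} {t : List ℕ}
    (h : c.blocks = (a + 2) :: t) : transition 0 c' ≠ c := by
  rw [Ne, Composition.ext_iff, transition_blocks c' (Nat.zero_le _), addBall, h]
  simp

/-- With at least two balls the truncation is nonempty, so `T_1` always yields a first part of at
least `2`, whereas `T_0` always yields a first part `1`. Thus only one of the two feeds a given
state. -/
theorem transition_one_blocks (c : Composition (n + 2)) : ∃ b u,
    (truncate c).blocks = (b + 1) :: u ∧ (transition 1 c).blocks = (b + 2) :: u := by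
  obtain ⟨b, u, h⟩ := List.exists_cons_of_ne_nil (blocks_ne_nil (truncate c))
  have hb : 0 < b := (truncate c).blocks_pos (by rw [h]; simp)
  obtain ⟨b, rfl⟩ := Nat.exists_eq_add_of_lt hb
  refine ⟨b, u, by rw [h, zero_add], ?_⟩
  rw [transition_blocks c (by simp [h]), h, zero_add, addBall]

theorem transition_one_eq_iff {c c' : Composition (n + 2)} {d : Composition (n + 1)} {a : ℕ}
    {t : List ℕ} (h : c.blocks = (a + 2) :: t) (hd : d.blocks = (a + 1) :: t) :
    transition 1 c' = c ↔ truncate c' = d := by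
  obtain ⟨b, u, h1, h2⟩ := transition_one_blocks c'
  rw [Composition.ext_iff, Composition.ext_iff, h1, h2, h, hd]
  simp

theorem transition_one_ne {c c' : Composition (n + 2)} {t : List ℕ}
    (h : c.blocks = 1 :: t) : transition 1 c' ≠ c := by
  obtain ⟨b, u, -, h2⟩ := transition_one_blocks c'
  rw [Ne, Composition.ext_iff, h2, h]
  simp

/-- The balance equation at `c`, when the rates `x_j` with `2 ≤ j ≤ m` do not feed the state `c` and
those with `j > m` do not alter it. -/
theorem IsBalanced.y_mul_eq {p : Composition (n + 2) → ℝ} (hp : IsBalanced (n + 2) x p)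
    {c : Composition (n + 2)} {m : ℕ} (hm : 1 ≤ m) (hmn : m < n + 2)
    (hc : ∀ j, 2 ≤ j → j < n + 2 →
      x j * inflow (transition j) p c = if j ≤ m then 0 else x j * p c) :
    y x m * p c = x 0 * inflow (transition 0) p c + x 1 * inflow (transition 1) p c := by
  have h := (vecMul_mapGenerator (T := transition) (x := x) p c).symm.trans (congrFun hp.2 c)
  rw [Pi.zero_apply, Finset.sum_range_succ', Finset.sum_range_succ'] at h
  have h2 : ∀ j ∈ range n, x (j + 1 + 1) * (inflow (transition (j + 1 + 1)) p c - p c)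
      = if j ∈ range (m - 1) then - (x (j + 2) * p c) else 0 := by
    intro j hj
    rw [mul_sub, hc (j + 2) (by omega) (by have := mem_range.1 hj; omega)]
    have : j ∈ range (m - 1) ↔ j + 2 ≤ m := by rw [mem_range]; omega
    simp only [this]
    split_ifs <;> simp
  rw [Finset.sum_congr rfl h2, Finset.sum_ite_mem, Finset.inter_eq_right.2
    (by intro j; simp only [mem_range]; omega), Finset.sum_neg_distrib, ← Finset.sum_mul] at h
  have h3 : y x m = ∑ j ∈ range (m - 1), x (j + 2) + x 1 + x 0 := by
    obtain ⟨m, rfl⟩ := Nat.exists_eq_add_of_le' hm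
    rw [y, Finset.sum_range_succ', Finset.sum_range_succ']
    simp
  rw [h3]
  simp only [zero_add] at h
  linarith

theorem IsBalanced.y_mul_eq_of_one {p : Composition (n + 2) → ℝ} (hp : IsBalanced (n + 2) x p)
    {c : Composition (n + 2)} {m : ℕ} (hm : 1 ≤ m) (hmn : m < n + 2)
    (hc : ∀ j, 2 ≤ j → j < n + 2 →
      x j * inflow (transition j) p c = if j ≤ m then 0 else x j * p c)
    {d : Composition (n + 1)} (h : c.blocks = 1 :: d.blocks) :
    y x m * p c = x 0 * inflow truncate p d := by
  rw [hp.y_mul_eq hm hmn hc, inflow_congr fun _ => transition_zero_eq_iff h,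
    inflow_eq_zero fun _ => transition_one_ne h, mul_zero, add_zero]

theorem IsBalanced.y_mul_eq_of_two_le {p : Composition (n + 2) → ℝ} (hp : IsBalanced (n + 2) x p)
    {c : Composition (n + 2)} {m : ℕ} (hm : 1 ≤ m) (hmn : m < n + 2)
    (hc : ∀ j, 2 ≤ j → j < n + 2 →
      x j * inflow (transition j) p c = if j ≤ m then 0 else x j * p c)
    {d : Composition (n + 1)} {a : ℕ} {t : List ℕ} (h : c.blocks = (a + 2) :: t)
    (hd : d.blocks = (a + 1) :: t) :
    y x m * p c = x 1 * inflow truncate p d := by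
  rw [hp.y_mul_eq hm hmn hc, inflow_congr (T := transition 1) fun _ => transition_one_eq_iff h hd,
    inflow_eq_zero fun _ => transition_zero_ne h, mul_zero, zero_add]

/-- For `j ≥ 2`, if `T_j` acts by moving a ball or as the boundary identity, some part after the
first is at least `2` whenever bin `j` survives the removal, which a hook excludes. So `T_j` can
reach a hook only from itself, by being idle. -/
theorem inflow_transition_hook {p : Composition (n + 1) → ℝ} {c : Composition (n + 1)} {a m : ℕ}
    (h : c.blocks = a :: List.replicate m 1) {j : ℕ} (hj : 2 ≤ j) :
    x j * inflow (transition j) p c = if j ≤ m then 0 else x j * p c := by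
  have hlen : c.length = m + 1 := by simp [Composition.length, h]
  have key : ∀ c' : Composition (n + 1), transition j c' = c → c' = c ∧ m < j := by
    intro c' hc'
    rcases lt_or_ge j c'.length with hlt | hge
    · exfalso
      have hle := le_length_removeLastBall hlt
      have e := transition_blocks c' hle
      obtain ⟨k, rfl⟩ := Nat.exists_eq_add_of_le' hj
      obtain ⟨i, hi, h2⟩ := exists_tail_addBall (fun _ hk => (truncate c').blocks_pos hk) hle
      rw [← e, hc', h, List.tail_cons] at hi
      have := List.eq_of_mem_replicate hi
      omega
    · rw [transition_of_le hge] at hc'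
      subst hc'
      exact ⟨rfl, by omega⟩
  split_ifs with hjm
  · rw [inflow_eq_zero fun c' hc' => absurd (key c' hc').2 (by omega), mul_zero]
  · rw [inflow_congr (S := fun i => i) (d := c) fun c' => ⟨fun hc' => (key c' hc').1, fun hc' => by
      rw [hc', transition_of_le (by omega)]⟩, inflow_id]

end Recursion

/-! ### Closed formulas by induction on `n`. -/

section Values

variable {x : ℕ → ℝ}

theorem y_pos {n k : ℕ} (hx : ∀ j, j < n → 0 ≤ x j) (hx0 : 0 < x 0) (hk : k < n) : 0 < y x k :=
  Finset.sum_pos' (fun j hj => hx j (by have := mem_range.1 hj; omega)) ⟨0, by simp, hx0⟩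

theorem IsBalanced.eq_one {p : Composition 1 → ℝ} (hp : IsBalanced 1 x p) (c : Composition 1) :
    p c = 1 := by
  have : Subsingleton (Composition 1) :=
    Fintype.card_le_one_iff_subsingleton.1 (by rw [composition_card]; norm_num)
  rw [← hp.1, Fintype.sum_subsingleton _ c]

theorem IsBalanced.apply_hook {n : ℕ} (hx : ∀ j, j < n → 0 ≤ x j) (hx0 : 0 < x 0)
    {p : Composition n → ℝ} (hp : IsBalanced n x p) {α m : ℕ} {c : Composition n}
    (hc : c.blocks = (α + 1) :: List.replicate (m + 1) 1) :
    p c = x 0 ^ (m + 1) * x 1 ^ α / (y x (m + 1) ^ (α + 1) * ∏ k ∈ Icc 1 m, y x k) := by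
  induction n generalizing α m with
  | zero => have := c.blocks_sum; simp [hc] at this
  | succ n ih =>
    have hs := c.blocks_sum
    simp only [hc, List.sum_cons, List.sum_replicate, smul_eq_mul, mul_one] at hs
    obtain ⟨n, rfl⟩ : ∃ k, n = k + 1 := ⟨n - 1, by omega⟩
    have hx' : ∀ j, j < n + 1 → 0 ≤ x j := fun j hj => hx j (by omega)
    have hin := fun j (hj : 2 ≤ j) (_ : j < n + 2) =>
      inflow_transition_hook (x := x) (p := p) hc hj
    have hy : 0 < y x (m + 1) := y_pos hx hx0 (by omega)
    rcases α with _ | α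
    · rcases m with _ | m
      -- For `(1, 1)` the recursion leads to `(1)`, which is outside the induction (its tail is
      -- empty); the mass there is `1`.
      · obtain rfl : n = 0 := by omega
        have h := hp.y_mul_eq_of_one (by omega) (by omega) hin (d := Composition.ones 1) hc
        rw [hp.inflow_truncate.eq_one] at h
        rw [eq_div_iff (by simpa using hy.ne')]
        simpa [mul_comm] using h
      · let d : Composition (n + 1) :=
          ⟨1 :: List.replicate (m + 1) 1, fun {i} hi => by simp at hi; omega, by simp; omega⟩
        have h := hp.y_mul_eq_of_one (by omega) (by omega) hin (d := d) hc
        rw [ih hx' hp.inflow_truncate (α := 0) (m := m) rfl] at h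
        have hy' : 0 < y x (m + 1) := y_pos hx hx0 (by omega)
        have hprod : 0 < ∏ k ∈ Icc 1 m, y x k :=
          Finset.prod_pos fun k hk => y_pos hx hx0 (by have := (mem_Icc.1 hk).2; omega)
        rw [Finset.prod_Icc_succ_top (by omega)]
        field_simp at h ⊢
        linear_combination h
    · let d : Composition (n + 1) :=
        ⟨(α + 1) :: List.replicate (m + 1) 1, fun {i} hi => by simp at hi; omega, by simp; omega⟩
      have h := hp.y_mul_eq_of_two_le (by omega) (by omega) hin (d := d) hc rfl
      rw [ih hx' hp.inflow_truncate (α := α) (m := m) rfl] at h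
      have hprod : 0 < ∏ k ∈ Icc 1 m, y x k :=
        Finset.prod_pos fun k hk => y_pos hx hx0 (by have := (mem_Icc.1 hk).2; omega)
      field_simp at h ⊢
      linear_combination h

/-- Every state now obeys the recursion with divisor `y_1`: a leading `1` is stripped at cost `x_0`,
a larger first part is lowered at cost `x_1`. The total number of steps is `n`. -/
theorem IsBalanced.apply_of_two_rates {n : ℕ} (hx : ∀ j, j < n + 1 → 0 ≤ x j) (hx0 : 0 < x 0)
    (hx2 : ∀ j, 2 ≤ j → j ≤ n → x j = 0) {p : Composition (n + 1) → ℝ}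
    (hp : IsBalanced (n + 1) x p) (c : Composition (n + 1)) :
    p c = x 0 ^ (c.length - 1) * x 1 ^ (n + 1 - c.length) / y x 1 ^ n := by
  induction n with
  | zero =>
    have h1 := c.length_le
    have h2 := c.length_pos_of_pos Nat.one_pos
    simp [hp.eq_one, show c.length = 1 by omega]
  | succ n ih =>
    have ih := ih (fun j hj => hx j (by omega)) (fun j h2 hj => hx2 j h2 (by omega))
      hp.inflow_truncate
    have hy : 0 < y x 1 := y_pos hx hx0 (by omega)
    have hin : ∀ j, 2 ≤ j → j < n + 2 →
        x j * inflow (transition j) p c = if j ≤ 1 then 0 else x j * p c := fun j h2 hj => by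
      rw [hx2 j h2 (by omega), zero_mul, zero_mul, ite_self]
    obtain ⟨a, t, hc⟩ := List.exists_cons_of_ne_nil (blocks_ne_nil c)
    have hs := c.blocks_sum
    rw [hc, List.sum_cons] at hs
    have ht : ∀ {i}, i ∈ t → 0 < i := fun {i} hi => c.blocks_pos (by rw [hc]; simp [hi])
    have ha : 0 < a := c.blocks_pos (by rw [hc]; simp)
    have hlen : c.length = t.length + 1 := by simp [Composition.length, hc]
    obtain rfl | ⟨a, rfl⟩ : a = 1 ∨ ∃ b, a = b + 2 := by
      rcases a with _ | _ | a
      exacts [absurd ha (lt_irrefl 0), Or.inl rfl, Or.inr ⟨a, rfl⟩]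
    · let d : Composition (n + 1) := ⟨t, ht, by omega⟩
      have h := hp.y_mul_eq_of_one le_rfl (by omega) hin (d := d) hc
      have hd : d.length = t.length := rfl
      have hd0 : 0 < d.length := d.length_pos_of_pos n.succ_pos
      obtain ⟨k, hk⟩ : ∃ k, t.length = k + 1 := ⟨t.length - 1, by omega⟩
      rw [ih, hd, hk] at h
      rw [hlen, hk]
      simp only [Nat.add_sub_cancel, Nat.add_sub_add_right] at h ⊢
      field_simp at h ⊢
      linear_combination h
    · let d : Composition (n + 1) :=
        ⟨(a + 1) :: t, fun {i} hi => (List.mem_cons.1 hi).elim (by omega) ht, by simp; omega⟩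
      have h := hp.y_mul_eq_of_two_le le_rfl (by omega) hin (d := d) hc rfl
      have hd : d.length = t.length + 1 := rfl
      have hd1 : d.length ≤ n + 1 := d.length_le
      rw [ih, hd] at h
      rw [hlen, show n + 1 + 1 - (t.length + 1) = n + 1 - (t.length + 1) + 1 by omega]
      field_simp at h ⊢
      linear_combination h

end Values
end HilbertGalton

theorem corollary2p8 (n : ℕ) (hn : 1 ≤ n) (x : ℕ → ℝ) (hx : ∀ j, j < n → 0 ≤ x j)
    (hx0 : 0 < x 0) (hx1 : 0 < x 1) :
    (∃! p : Composition n → ℝ, HilbertGalton.IsStationaryDistribution n x p) ∧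
    ∀ p : Composition n → ℝ, HilbertGalton.IsStationaryDistribution n x p →
      (∀ (α l : ℕ) (hα : 1 ≤ α) (_ : 2 ≤ l) (hαl : α + (l - 1) = n),
        p (HilbertGalton.hook α l hα hαl) =
          x 0 ^ (l - 1) * x 1 ^ (α - 1) /
            (HilbertGalton.y x (l - 1) ^ α *
              ∏ k ∈ Finset.Icc 1 (l - 2), HilbertGalton.y x k)) ∧
      ((∀ j, 2 ≤ j → j ≤ n - 1 → x j = 0) →
        ∀ c : Composition n,
          p c = x 0 ^ (c.length - 1) * x 1 ^ (n - c.length) /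
            HilbertGalton.y x 1 ^ (n - 1)) := by
  refine ⟨HilbertGalton.existsUnique_isStationaryDistribution hx hx0, fun p hp => ⟨?_, ?_⟩⟩
  · intro α l hα hl hαl
    obtain ⟨a, rfl⟩ := Nat.exists_eq_add_of_le' hα
    obtain ⟨m, rfl⟩ := Nat.exists_eq_add_of_le' hl
    exact (HilbertGalton.isStationaryDistribution_iff.1 hp).2.apply_hook hx hx0 rfl
  · intro hx2 c
    obtain ⟨n, rfl⟩ := Nat.exists_eq_add_of_le' hn
    exact (HilbertGalton.isStationaryDistribution_iff.1 hp).2.apply_of_two_rates hx hx0 hx2 c
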